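/- Let $d,n\ge 1$. For $v\in S^{d-1}$ and $\beta\in[-\infty,\infty]$ put $H^+(\beta,v)=\{y\in\mathbb R^d:\langle y,v\rangle\ge\beta\}$ and $H^-(\beta,v)=\{y\in\mathbb R^d:\langle y,v\rangle\le\beta\}$ (so for $\beta=\pm\infty$ one of the two sets is empty and the other is $\mathbb R^d$). Given a set $\mathcal A$ of ordered partitions of $\mathbb R^d$ into $n$ pieces, a set $\mathcal B$ of ordered partitions into $m$ pieces, and $v\in S^{d-1}$, let the join $\mathcal A *_v\mathcal B$ be the set of all partitions into $n+m$ pieces $$\bigl(C_1\cap H^+(\beta,v),\dots,C_n\cap H^+(\beta,v),\;D_1\cap H^-(\beta,v),\dots,D_m\cap H^-(\beta,v)\bigr)$$ with $(C_1,\dots,C_n)\in\mathcal A$, $(D_1,\dots,D_m)\in\mathcal B$ and $\beta\in[-\infty,\infty]$ (pieces may be empty). A *space of nested hyperplane partitions of $\mathbb R^d$ with fixed directions* is a space obtained from copies of the one-element space $\{(\mathbb R^d)\}$ of partitions into one piece by finitely many joins, each along some fixed direction in $S^{d-1}$. A partition $(C_1,\dots,C_n)$ is *envy-free* for measures $\mu_1,\dots,\mu_n$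 if there is a permutation $\pi$ of $[n]$ with $\mu_i(C_{\pi(i)})\ge\mu_i(C_j)$ for all $i,j\in[n]$; such a $\pi$ is called an envy-free assignment. Let $A$ be a space of nested hyperplane partitions of $\mathbb R^d$ into $n$ pieces with fixed directions. Then: 1. For any finite Borel measures $\mu_1,\dots,\mu_n$ on $\mathbb R^d$ that are absolutely continuous with respect to Lebesgue measure, some partition in $A$ is envy-free for $\mu_1,\dots,\mu_n$. 2. The partition can be found without access to one of the measures: for every $i_0\in[n]$ and all finite absolutely continuous measures $\mu_i$ ($i\ne i_0$) there is a partition $(C_1,\dots,C_n)\in A$ such that for every finite absolutely continuous measure $\mu_{i_0}$ and every piece $C_k$ of largest $\mu_{i_0}$-measure there is an envy-free assignment $\pi$ for $\mu_1,\dots,\mu_n$ with $\pi(i_0)=k$. In particular, this partition is envy-free for $\mu_1,\dots,\mu_n$, whatever $\mu_{i_0}$ is. -/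

import Mathlib

open MeasureTheory

/-- The closed half-space `{y | ⟨y, v⟩ ≥ β}`, where `β ∈ [-∞, ∞]`: it is empty for `β = ∞` and the
whole space for `β = -∞`. -/
def halfSpaceGE {d : ℕ} (β : EReal) (v : EuclideanSpace ℝ (Fin d)) :
    Set (EuclideanSpace ℝ (Fin d)) :=
  {y | β ≤ ((inner ℝ y v : ℝ) : EReal)}

/-- The closed half-space `{y | ⟨y, v⟩ ≤ β}`, where `β ∈ [-∞, ∞]`: it is the whole space for
`β = ∞` and empty for `β = -∞`. -/
def halfSpaceLE {d : ℕ} (β : EReal) (v : EuclideanSpace ℝ (Fin d)) :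
    Set (EuclideanSpace ℝ (Fin d)) :=
  {y | ((inner ℝ y v : ℝ) : EReal) ≤ β}

/-- The join of a space `A` of ordered partitions into `n` pieces and a space `B` of ordered
partitions into `m` pieces in the direction `v`: cut by a hyperplane orthogonal to `v` (possibly at
infinity), use a partition of `A` on one side and a partition of `B` on the other side. -/
def joinSpace {d n m : ℕ} (v : EuclideanSpace ℝ (Fin d))
    (A : Set (Fin n → Set (EuclideanSpace ℝ (Fin d))))
    (B : Set (Fin m → Set (EuclideanSpace ℝ (Fin d)))) :
    Set (Fin (n + m) → Set (EuclideanSpace ℝ (Fin d))) :=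
  {P | ∃ C ∈ A, ∃ D ∈ B, ∃ β : EReal,
    P = Fin.append (fun j => C j ∩ halfSpaceGE β v) (fun k => D k ∩ halfSpaceLE β v)}

/-- `IsNestedHyperplaneSpace n A` says that `A` is a space of nested hyperplane partitions of `ℝᵈ`
into `n` pieces with fixed directions: it is obtained from copies of the one-element space
`{(ℝᵈ)}` by repeated joins, each along some fixed direction of the unit sphere. -/
inductive IsNestedHyperplaneSpace {d : ℕ} :
    (n : ℕ) → Set (Fin n → Set (EuclideanSpace ℝ (Fin d))) → Prop
  | trivial : IsNestedHyperplaneSpace 1 {fun _ => Set.univ}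
  | join {n m : ℕ} {A : Set (Fin n → Set (EuclideanSpace ℝ (Fin d)))}
      {B : Set (Fin m → Set (EuclideanSpace ℝ (Fin d)))} (v : EuclideanSpace ℝ (Fin d)) :
      ‖v‖ = 1 → IsNestedHyperplaneSpace n A → IsNestedHyperplaneSpace m B →
      IsNestedHyperplaneSpace (n + m) (joinSpace v A B)

/-- Giving the piece `C (π i)` to the measure `μ i` makes no measure envious: every measure receives
a piece which is largest for it. -/
def IsEnvyFreeAssignment {d n : ℕ} (μ : Fin n → Measure (EuclideanSpace ℝ (Fin d)))
    (C : Fin n → Set (EuclideanSpace ℝ (Fin d))) (π : Equiv.Perm (Fin n)) : Prop :=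
  ∀ i j, μ i (C j) ≤ μ i (C (π i))

/-- `C` is an envy-free partition for `μ`: some assignment of the pieces is envy-free. -/
def IsEnvyFreePartition {d n : ℕ} (μ : Fin n → Measure (EuclideanSpace ℝ (Fin d)))
    (C : Fin n → Set (EuclideanSpace ℝ (Fin d))) : Prop :=
  ∃ π : Equiv.Perm (Fin n), IsEnvyFreeAssignment μ C π

/-! A nested space is parametrized by a simplex: coordinate `k` controls piece `k`, the piece is
empty when its coordinate vanishes, and measures of pieces vary continuously
(`IsNestedHyperplaneSpace.exists_isOrthantParametrization`). What remains is to choose a point of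
the simplex.

For each agent except the secretive one, spread weight 1 over the pieces that are nearly best for
it. The average of these weights is a continuous self-map of the simplex preserving faces, so it
attains the barycentre (`exists_le_inv_card_of_continuousOn`). There no piece carries more than its
share of the `n - 1` units of weight, and Hall's theorem matches the agents to nearly best pieces
while avoiding any prescribed piece (`exists_injective_avoiding`). Compactness removes the error,
and the avoided piece goes to the secretive agent.

The topological input is proved combinatorially: a parity argument gives Scarf's lemma
(`exists_dominant_image`), which is applied to fine grids in the simplex. -/

/-! ### Scarf's lemma by a parity argument -/

/-- A finite set `S` is dominant for a family of orders if no element lies strictly above the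
minimum of `S` in each of the orders. -/
def IsDominant {X I α : Type*} [LinearOrder α] (φ : I → X → α) (S : Finset X) : Prop :=
  ∀ y, ∃ i, ∀ s ∈ S, φ i y ≤ φ i s

theorem IsDominant.mono {X I α : Type*} [LinearOrder α] {φ : I → X → α} {R S : Finset X}
    (hS : IsDominant φ S) (h : R ⊆ S) : IsDominant φ R := fun y =>
  (hS y).imp fun _ hi s hs => hi s (h hs)

/-- Dominance tested at a member `r` says that `r` is the minimum of `S` in some order, and an order
has only one minimum. If `S` has as many elements as there are orders, each element owns exactly one
order. -/
theorem IsDominant.exists_argmin {X I α : Type*} [LinearOrder α]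
    {φ : I → X → α} (hφ : ∀ i, Function.Injective (φ i)) {S : Finset X} (hS : IsDominant φ S) :
    ∃ e : S → I, Function.Injective e ∧ ∀ r : S, ∀ s ∈ S, φ (e r) r ≤ φ (e r) s := by
  choose e he using fun r : S => hS r
  refine ⟨e, fun r r' h => ?_, he⟩
  have h1 := he r r' r'.2
  have h2 := he r' r r.2
  rw [← h] at h2
  exact Subtype.ext (hφ _ (le_antisymm h1 h2))

/-- `y` lies strictly above the minimum of `R` in each of the orders except possibly the `i`-th. -/
def IsAboveExcept {X I α : Type*} [LinearOrder α] (φ : I → X → α) (R : Finset X) (i : I)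
    (y : X) : Prop :=
  ∀ j ≠ i, ∃ r ∈ R, φ j r < φ j y

theorem IsDominant.le_of_isAboveExcept {X I α : Type*} [LinearOrder α]
    {φ : I → X → α} {R : Finset X} (hR : IsDominant φ R) {i : I} {y : X}
    (hy : IsAboveExcept φ R i y) : ∀ s ∈ R, φ i y ≤ φ i s := by
  obtain ⟨j, hj⟩ := hR y
  have hji : j = i := by
    by_contra h
    obtain ⟨r, hr, h'⟩ := hy j h
    exact absurd (hj r hr) (not_le.2 h')
  exact hji ▸ hj

/-- Adding `y` does not change the minimum of `R` in the orders `j ≠ i`, and in order `i` the new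
minimum is `y`. Elements above the old minima outside order `i` are controlled by maximality of `y`;
all others are already blocked in some `j ≠ i`. -/
theorem IsDominant.insert_of_isMax {X I α : Type*} [DecidableEq X] [LinearOrder α]
    {φ : I → X → α} {R : Finset X} (hR : IsDominant φ R) {i : I} {y : X}
    (hy : IsAboveExcept φ R i y) (hmax : ∀ z, IsAboveExcept φ R i z → φ i z ≤ φ i y) :
    IsDominant φ (insert y R) := by
  intro z
  by_cases hz : IsAboveExcept φ R i z
  · refine ⟨i, fun s hs => ?_⟩
    rcases Finset.mem_insert.1 hs with rfl | hs
    · exact hmax z hz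
    · exact hR.le_of_isAboveExcept hz s hs
  · unfold IsAboveExcept at hz
    push Not at hz
    obtain ⟨j, hji, hj⟩ := hz
    refine ⟨j, fun s hs => ?_⟩
    rcases Finset.mem_insert.1 hs with rfl | hs
    · obtain ⟨r, hr, h⟩ := hy j hji
      exact (hj r hr).trans h.le
    · exact hj s hs

/-- Converse of the previous construction. Each element of `insert y R` owns exactly one order; `t`
cannot own both `a` and `b`, and no other element of `R` can own either, so `y` owns one of them. -/
theorem IsDominant.isMax_of_insert {X I α : Type*} [Fintype I] [DecidableEq X]
    [LinearOrder α] {φ : I → X → α} (hφ : ∀ i, Function.Injective (φ i)) {R : Finset X}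
    (hcard : R.card + 1 = Fintype.card I) {y : X} (hy : y ∉ R)
    (hS : IsDominant φ (insert y R)) {a b : I} (hab : a ≠ b) {t : X} (ht : t ∈ R)
    (hta : ∀ s ∈ R, φ a t ≤ φ a s) (htb : ∀ s ∈ R, φ b t ≤ φ b s) :
    ∃ i, (i = a ∨ i = b) ∧ IsAboveExcept φ R i y ∧
      ∀ z, IsAboveExcept φ R i z → φ i z ≤ φ i y := by
  obtain ⟨e, he, hmin⟩ := hS.exists_argmin hφ
  have hbij : Function.Bijective e := by
    rw [Fintype.bijective_iff_injective_and_card]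
    refine ⟨he, ?_⟩
    rw [Fintype.card_coe, Finset.card_insert_of_notMem hy, hcard]
  have hyS : y ∈ insert y R := Finset.mem_insert_self y R
  have key : ∀ j ≠ e ⟨y, hyS⟩, ∃ r, ∃ hr : r ∈ R, e ⟨r, Finset.mem_insert_of_mem hr⟩ = j := by
    intro j hj
    obtain ⟨⟨r, hr⟩, rfl⟩ := hbij.2 j
    rcases Finset.mem_insert.1 hr with rfl | hr'
    · exact absurd rfl hj
    · exact ⟨r, hr', rfl⟩
  refine ⟨e ⟨y, hyS⟩, ?_, ?_, ?_⟩
  · by_contra! h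
    have aux : ∀ c, c ≠ e ⟨y, hyS⟩ → (∀ s ∈ R, φ c t ≤ φ c s) →
        e ⟨t, Finset.mem_insert_of_mem ht⟩ = c := by
      intro c hc htc
      obtain ⟨r, hr, rfl⟩ := key c hc
      have h1 := hmin ⟨r, Finset.mem_insert_of_mem hr⟩ t (Finset.mem_insert_of_mem ht)
      have := hφ _ (le_antisymm (htc r hr) h1)
      subst this
      rfl
    exact hab ((aux a h.1.symm hta).symm.trans (aux b h.2.symm htb))
  · intro j hj
    obtain ⟨r, hr, rfl⟩ := key j hj
    refine ⟨r, hr, lt_of_le_of_ne (hmin ⟨r, Finset.mem_insert_of_mem hr⟩ y hyS) fun h => ?_⟩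
    exact hy (hφ _ h ▸ hr)
  · intro z hz
    obtain ⟨j, hj⟩ := hS z
    have hji : j = e ⟨y, hyS⟩ := by
      by_contra h
      obtain ⟨r, hr, h'⟩ := hz j h
      exact absurd (hj r (Finset.mem_insert_of_mem hr)) (not_le.2 h')
    exact hji ▸ hj y hyS

/-- A dominant `R` with one element fewer than there are orders has exactly one element that is
minimal in two orders, `a` and `b`. Completing `R` means handing one of these to a new element, and
the maximal choice is forced: two completions in all. A non-dominant `R` has none. -/
theorem even_card_isDominant_insert {X I α : Type*} [Fintype X] [Fintype I] [DecidableEq X]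
    [LinearOrder α] {φ : I → X → α} (hφ : ∀ i, Function.Injective (φ i)) {R : Finset X}
    (hcard : R.card + 1 = Fintype.card I) (hne : R.Nonempty)
    (habove : ∀ i, ∃ y, IsAboveExcept φ R i y) [DecidablePred fun y => y ∉ R ∧ IsDominant φ (insert y R)] :
    Even (Finset.univ.filter fun y => y ∉ R ∧ IsDominant φ (insert y R)).card := by
  classical
  by_cases hR : IsDominant φ R
  swap
  · rw [Finset.filter_false_of_mem]
    · simp
    · rintro y - ⟨-, h⟩
      exact hR (h.mono (Finset.subset_insert _ _))
  obtain ⟨e, he, hmin⟩ := hR.exists_argmin hφ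
  obtain ⟨a, ha⟩ : ∃ a, ∀ r, e r ≠ a := by
    by_contra! h
    have := Fintype.card_le_of_surjective e h
    rw [Fintype.card_coe] at this
    omega
  obtain ⟨t, ht, hta⟩ := R.exists_min_image (φ a) hne
  have hmax : ∀ i, ∃ y, IsAboveExcept φ R i y ∧ ∀ z, IsAboveExcept φ R i z → φ i z ≤ φ i y := by
    intro i
    obtain ⟨y₀, hy₀⟩ := habove i
    obtain ⟨y, hy, h⟩ := (Finset.univ.filter (IsAboveExcept φ R i)).exists_max_image (φ i)
      ⟨y₀, by simpa using hy₀⟩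
    exact ⟨y, by simpa using hy, fun z hz => h z (by simpa using hz)⟩
  have hab : a ≠ e ⟨t, ht⟩ := (ha _).symm
  -- Every member of `R` is minimal in some order other than `i`: its own, or the spare order `a` if
  -- it is `t` and `i` is its own.
  have hdisj : ∀ i, (i = a ∨ i = e ⟨t, ht⟩) → ∀ y, IsAboveExcept φ R i y → y ∉ R := by
    intro i hi y hy hyR
    obtain ⟨j, hji, hj⟩ : ∃ j ≠ i, ∀ s ∈ R, φ j y ≤ φ j s := by
      by_cases h : e ⟨y, hyR⟩ = i
      · rcases hi with rfl | rfl
        · exact absurd h (ha _)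
        · have : y = t := congrArg Subtype.val (he h)
          exact ⟨a, hab, this ▸ hta⟩
      · exact ⟨_, h, hmin ⟨y, hyR⟩⟩
    obtain ⟨r, hr, h⟩ := hy j hji
    exact absurd (hj r hr) (not_le.2 h)
  obtain ⟨ya, hya, hya'⟩ := hmax a
  obtain ⟨yb, hyb, hyb'⟩ := hmax (e ⟨t, ht⟩)
  have hyab : ya ≠ yb := by
    rintro rfl
    obtain ⟨r, hr, h⟩ := hyb a hab
    exact absurd (hR.le_of_isAboveExcept hya r hr) (not_le.2 h)
  have : (Finset.univ.filter fun y => y ∉ R ∧ IsDominant φ (insert y R)) = {ya, yb} := by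
    ext y
    simp only [Finset.mem_filter, Finset.mem_univ, true_and, Finset.mem_insert,
      Finset.mem_singleton]
    constructor
    · rintro ⟨hy, hS⟩
      obtain ⟨i, hi, h1, h2⟩ := hS.isMax_of_insert hφ hcard hy hab ht hta (hmin ⟨t, ht⟩)
      rcases hi with rfl | rfl
      · exact Or.inl (hφ _ (le_antisymm (hya' _ h1) (h2 _ hya)))
      · exact Or.inr (hφ _ (le_antisymm (hyb' _ h1) (h2 _ hyb)))
    · rintro (rfl | rfl)
      · exact ⟨hdisj _ (Or.inl rfl) _ hya, hR.insert_of_isMax hya hya'⟩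
      · exact ⟨hdisj _ (Or.inr rfl) _ hyb, hR.insert_of_isMax hyb hyb'⟩
  rw [this, Finset.card_pair hyab]
  exact even_two

/-- A finite set whose colours are not all colours has an even number of facets whose colours are
exactly all colours but one. -/
theorem even_card_image_erase {X I : Type*} [Fintype I] [DecidableEq X] [DecidableEq I]
    (c : X → I) (i₀ : I) {S : Finset X} (hcard : S.card = Fintype.card I)
    (hS : S.image c ≠ Finset.univ) :
    Even (S.filter fun x => (S.erase x).image c = Finset.univ.erase i₀).card := by
  by_cases h : ∃ x ∈ S, (S.erase x).image c = Finset.univ.erase i₀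
  swap
  · push Not at h
    rw [Finset.filter_false_of_mem h]
    simp
  obtain ⟨x, hx, h⟩ := h
  have hcx : c x ≠ i₀ := by
    intro hc
    apply hS
    rw [← Finset.insert_erase hx, Finset.image_insert, h, hc, Finset.insert_erase (Finset.mem_univ _)]
  have hinj : Set.InjOn c (S.erase x : Finset X) := by
    rw [← Finset.card_image_iff, h, Finset.card_erase_of_mem hx,
      Finset.card_erase_of_mem (Finset.mem_univ _), hcard, Finset.card_univ]
  have hcx' : c x ∈ (S.erase x).image c := by
    rw [h]; simpa using hcx
  -- Exactly one colour is repeated, by `x` and `x'`; only the removal of one of these two keeps all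
  -- colours.
  obtain ⟨x', hx', hxx'⟩ := Finset.mem_image.1 hcx'
  have hx'S := Finset.mem_of_mem_erase hx'
  have hne := Finset.ne_of_mem_erase hx'
  have : (S.filter fun x => (S.erase x).image c = Finset.univ.erase i₀) = {x, x'} := by
    ext z
    simp only [Finset.mem_filter, Finset.mem_insert, Finset.mem_singleton]
    constructor
    · rintro ⟨hz, hz'⟩
      by_contra! hzx
      have hcz : c z ∈ (S.erase z).image c := by
        rw [hz', ← h]
        exact Finset.mem_image_of_mem c (Finset.mem_erase.2 ⟨hzx.1, hz⟩)
      obtain ⟨w, hw, hwz⟩ := Finset.mem_image.1 hcz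
      have hwS := Finset.mem_of_mem_erase hw
      have hwz' := Finset.ne_of_mem_erase hw
      by_cases hwx : w = x
      · subst hwx
        exact hzx.2 (hinj (Finset.mem_coe.2 (Finset.mem_erase.2 ⟨hzx.1, hz⟩)) hx'
          (hwz.symm.trans hxx'.symm))
      · exact hwz' (hinj (Finset.mem_coe.2 (Finset.mem_erase.2 ⟨hwx, hwS⟩))
          (Finset.mem_coe.2 (Finset.mem_erase.2 ⟨hzx.1, hz⟩)) hwz)
    · rintro (rfl | rfl)
      · exact ⟨hx, h⟩
      · refine ⟨hx'S, ?_⟩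
        rw [← h]
        ext i
        simp only [Finset.mem_image, Finset.mem_erase]
        constructor
        · rintro ⟨w, ⟨hw, hwS⟩, rfl⟩
          by_cases hwx : w = x
          · exact ⟨z, ⟨hne, hx'S⟩, hwx ▸ hxx'⟩
          · exact ⟨w, ⟨hwx, hwS⟩, rfl⟩
        · rintro ⟨w, ⟨hw, hwS⟩, rfl⟩
          by_cases hwx : w = z
          · exact ⟨x, ⟨hne.symm, hx⟩, hwx ▸ hxx'.symm⟩
          · exact ⟨w, ⟨hwx, hwS⟩, rfl⟩
  rw [this, Finset.card_pair hne.symm]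
  exact even_two

/-- Double counting of inclusions between doors (sets with all colours but `i₀`) and rooms (dominant
sets of full size). Without a rainbow room every room has evenly many doors, while every door lies
in evenly many rooms except `R₀`, which lies in one. -/
theorem exists_rainbow_isDominant {X I α : Type*} [Fintype X] [Fintype I] [DecidableEq X]
    [DecidableEq I] [LinearOrder α] {φ : I → X → α} (hφ : ∀ i, Function.Injective (φ i))
    (c : X → I) (i₀ : I) (R₀ : Finset X) (hc₀ : R₀.image c = Finset.univ.erase i₀)
    (hcard : R₀.card + 1 = Fintype.card I)
    (hodd : ∃! y, y ∉ R₀ ∧ IsDominant φ (insert y R₀))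
    (habove : ∀ R : Finset X, R.card + 1 = Fintype.card I → R.image c = Finset.univ.erase i₀ →
      R ≠ R₀ → ∀ i, ∃ y, IsAboveExcept φ R i y) :
    ∃ S : Finset X, IsDominant φ S ∧ S.image c = Finset.univ := by
  classical
  by_contra! hcon
  set doors : Finset (Finset X) := Finset.univ.filter fun R =>
    R.card + 1 = Fintype.card I ∧ R.image c = Finset.univ.erase i₀ with hdoors
  set rooms : Finset (Finset X) := Finset.univ.filter fun S =>
    S.card = Fintype.card I ∧ IsDominant φ S with hrooms
  have hcount := Finset.sum_card_bipartiteAbove_eq_sum_card_bipartiteBelow (s := doors)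
    (t := rooms) (fun R S => R ⊆ S)
  have h1 : ∀ R ∈ doors, (rooms.bipartiteAbove (fun R S => R ⊆ S) R).card =
      (Finset.univ.filter fun y => y ∉ R ∧ IsDominant φ (insert y R)).card := by
    intro R hR
    obtain ⟨hR1, hR2⟩ := (Finset.mem_filter.1 hR).2
    symm
    refine Finset.card_bij (fun y _ => insert y R) ?_ ?_ ?_
    · intro y hy
      obtain ⟨hy1, hy2⟩ := (Finset.mem_filter.1 hy).2
      simp [Finset.bipartiteAbove, hrooms, Finset.card_insert_of_notMem hy1, hR1, hy2]
    · intro y hy z hz h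
      exact (Finset.insert_inj (Finset.mem_filter.1 hy).2.1).1 h
    · intro S hS
      simp only [Finset.bipartiteAbove, hrooms, Finset.mem_filter, Finset.mem_univ,
        true_and] at hS
      obtain ⟨y, hy, rfl⟩ := Finset.exists_eq_insert_iff.2 ⟨hS.2, hR1.trans hS.1.1.symm⟩
      exact ⟨y, by simpa using ⟨hy, hS.1.2⟩, rfl⟩
  have h2 : ∀ S ∈ rooms, (doors.bipartiteBelow (fun R S => R ⊆ S) S).card =
      (S.filter fun x => (S.erase x).image c = Finset.univ.erase i₀).card := by
    intro S hS
    obtain ⟨hS1, hS2⟩ := (Finset.mem_filter.1 hS).2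
    symm
    refine Finset.card_bij (fun x _ => S.erase x) ?_ ?_ ?_
    · intro x hx
      obtain ⟨hx1, hx2⟩ := Finset.mem_filter.1 hx
      simp [Finset.bipartiteBelow, hdoors, hx2, Finset.erase_subset,
        Finset.card_erase_add_one hx1, hS1]
    · intro y hy z hz h
      exact (Finset.erase_inj S (Finset.mem_filter.1 hy).1).1 h
    · intro R hR
      simp only [Finset.bipartiteBelow, hdoors, Finset.mem_filter, Finset.mem_univ,
        true_and] at hR
      obtain ⟨y, hy, rfl⟩ := Finset.exists_eq_insert_iff.2 ⟨hR.2, hR.1.1.trans hS1.symm⟩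
      have h3 : (insert y R).erase y = R := Finset.erase_insert hy
      exact ⟨y, by simpa [h3] using hR.1.2, h3⟩
  rw [Finset.sum_congr rfl h1, Finset.sum_congr rfl h2] at hcount
  have heven : Even (∑ S ∈ rooms,
      (S.filter fun x => (S.erase x).image c = Finset.univ.erase i₀).card) := by
    refine Finset.even_sum _ fun S hS => ?_
    obtain ⟨hS1, hS2⟩ := (Finset.mem_filter.1 hS).2
    exact even_card_image_erase c i₀ hS1 (hcon S hS2)
  have hR₀ : R₀ ∈ doors := by simp [hdoors, hcard, hc₀]
  rw [← hcount, ← Finset.add_sum_erase _ _ hR₀] at heven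
  have heven' : Even (∑ R ∈ doors.erase R₀,
      (Finset.univ.filter fun y => y ∉ R ∧ IsDominant φ (insert y R)).card) := by
    refine Finset.even_sum _ fun R hR => ?_
    obtain ⟨hne, hR⟩ := Finset.mem_erase.1 hR
    obtain ⟨hR1, hR2⟩ := (Finset.mem_filter.1 hR).2
    refine even_card_isDominant_insert hφ hR1 ?_ (habove R hR1 hR2 hne)
    rw [Finset.nonempty_iff_ne_empty]
    rintro rfl
    have : R₀.card = 0 := by simp at hR1; omega
    exact hne (Finset.card_eq_zero.1 this).symm
  have hone : (Finset.univ.filter fun y => y ∉ R₀ ∧ IsDominant φ (insert y R₀)).card = 1 := by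
    obtain ⟨y, hy, hy'⟩ := hodd
    rw [Finset.card_eq_one]
    refine ⟨y, ?_⟩
    ext z
    simp only [Finset.mem_filter, Finset.mem_univ, true_and, Finset.mem_singleton]
    exact ⟨fun h => hy' z h, fun h => h ▸ hy⟩
  rw [hone] at heven
  have := (Nat.even_add.1 heven).2 heven'
  exact absurd this (by decide)

/-- Scarf's lemma for indexed linear orders: for every colouring of a finite set by the indices of
a family of linear orders there is a set `σ` such that no element lies strictly above the minimum
of `σ` in each of the orders indexed by the colours of `σ`. -/
theorem exists_dominant_image {T I : Type*} [Fintype T] [Nonempty T] [Fintype I]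
    [Nonempty I] [DecidableEq I] (ψ : I → T → ℕ) (hψ : ∀ i, Function.Injective (ψ i)) (c : T → I) :
    ∃ σ : Finset T, ∀ y, ∃ i ∈ σ.image c, ∀ s ∈ σ, ψ i y ≤ ψ i s := by
  classical
  set B : ℕ := ∑ i, ∑ t, ψ i t with hB
  have hψB : ∀ i t, ψ i t ≤ B := fun i t =>
    (Finset.single_le_sum (f := ψ i) (fun _ _ => Nat.zero_le _) (Finset.mem_univ t)).trans
      (Finset.single_le_sum (f := fun i => ∑ t, ψ i t) (fun _ _ => Nat.zero_le _)
        (Finset.mem_univ i))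
  let e := Fintype.equivFin I
  -- One slack element per order is added: lowest in its own order, above all of `T` in the others.
  -- The shift by 1 keeps 0 free, and `e j` keeps the large values distinct.
  let φ : I → T ⊕ I → ℕ := fun i x => Sum.elim (fun t => ψ i t + 1)
    (fun j => if j = i then 0 else B + 2 + (e j : ℕ)) x
  have hφl : ∀ i t, φ i (Sum.inl t) = ψ i t + 1 := fun i t => rfl
  have hφr : ∀ i, φ i (Sum.inr i) = 0 := fun i => by simp [φ]
  have hφr' : ∀ i j, j ≠ i → φ i (Sum.inr j) = B + 2 + e j := fun i j h => by simp [φ, h]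
  have hφ : ∀ i, Function.Injective (φ i) := by
    rintro i (t | j) (t' | j') h
    · rw [hφl, hφl] at h
      exact congrArg _ (hψ i (by omega))
    · have := hψB i t
      by_cases hj : j' = i
      · rw [hj, hφl, hφr] at h; omega
      · rw [hφl, hφr' _ _ hj] at h; omega
    · have := hψB i t'
      by_cases hj : j = i
      · rw [hj, hφl, hφr] at h; omega
      · rw [hφl, hφr' _ _ hj] at h; omega
    · by_cases hj : j = i <;> by_cases hj' : j' = i
      · rw [hj, hj']
      · rw [hj, hφr, hφr' _ _ hj'] at h; omega
      · rw [hj', hφr, hφr' _ _ hj] at h; omega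
      · rw [hφr' _ _ hj, hφr' _ _ hj'] at h
        exact congrArg _ (e.injective (Fin.ext (by omega)))
  let c' : T ⊕ I → I := Sum.elim c id
  obtain ⟨i₀⟩ := ‹Nonempty I›
  set R₀ : Finset (T ⊕ I) := (Finset.univ.erase i₀).image Sum.inr with hR₀
  have hmem₀ : ∀ j, Sum.inr j ∈ R₀ ↔ j ≠ i₀ := by simp [hR₀]
  have hmem₀' : ∀ t, Sum.inl t ∉ R₀ := by simp [hR₀]
  obtain ⟨S, hS, hcS⟩ := exists_rainbow_isDominant hφ c' i₀ R₀
    (by rw [hR₀, Finset.image_image]; exact Finset.image_id)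
    (by
      rw [hR₀, Finset.card_image_of_injective _ Sum.inr_injective,
        Finset.card_erase_add_one (Finset.mem_univ _), Finset.card_univ])
    (by
      -- The only completion of the slack door is the `i₀`-largest element of `T`.
      obtain ⟨t, -, ht⟩ := (Finset.univ : Finset T).exists_max_image (ψ i₀) Finset.univ_nonempty
      refine ⟨Sum.inl t, ⟨hmem₀' t, ?_⟩, ?_⟩
      · rintro (z | i)
        · refine ⟨i₀, fun s hs => ?_⟩
          rcases Finset.mem_insert.1 hs with rfl | hs
          · have := ht z (Finset.mem_univ _)
            rw [hφl, hφl]; omega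
          · rcases s with s | j
            · exact absurd hs (hmem₀' s)
            · have := hψB i₀ z
              rw [hφl, hφr' _ _ ((hmem₀ j).1 hs)]; omega
        · exact ⟨i, fun s _ => by rw [hφr]; exact Nat.zero_le _⟩
      · rintro y ⟨hy, hdom⟩
        have key : ∀ z : T, φ i₀ (Sum.inl z) ≤ φ i₀ y := by
          intro z
          obtain ⟨i, hi⟩ := hdom (Sum.inl z)
          by_cases hii : i = i₀
          · exact hii ▸ hi y (Finset.mem_insert_self _ _)
          · have := hi (Sum.inr i) (Finset.mem_insert_of_mem ((hmem₀ i).2 hii))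
            rw [hφl, hφr] at this
            omega
        rcases y with y | j
        · have h1 := key t
          have h2 := ht y (Finset.mem_univ _)
          rw [hφl, hφl] at h1
          exact congrArg _ (hψ i₀ (by omega))
        · rw [hmem₀, not_not] at hy
          have := key t
          rw [hy, hφl, hφr] at this
          omega)
    (by
      intro R hcard hc hne i
      obtain ⟨t, ht⟩ : ∃ t, Sum.inl t ∈ R := by
        by_contra! h
        apply hne
        have hsub : R ⊆ R₀ := by
          rintro (t | j) hx
          · exact absurd hx (h t)
          · rw [hmem₀]
            have : c' (Sum.inr j) ∈ R.image c' := Finset.mem_image_of_mem _ hx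
            rw [hc] at this
            exact Finset.ne_of_mem_erase this
        refine Finset.eq_of_subset_of_card_le hsub ?_
        rw [hR₀, Finset.card_image_of_injective _ Sum.inr_injective,
          Finset.card_erase_of_mem (Finset.mem_univ _), Finset.card_univ]
        omega
      -- Slack `i` exceeds `t` in every order but the `i`-th.
      refine ⟨Sum.inr i, fun j hj => ⟨_, ht, ?_⟩⟩
      have := hψB j t
      rw [hφl, hφr' _ _ hj.symm]
      omega)
  -- Discarding slacks loses no needed colour: if slack `i` is in `S`, the minimum in order `i` is
  -- 0, so `i` cannot block an element of `T`.
  refine ⟨Finset.univ.filter fun t => Sum.inl t ∈ S, fun y => ?_⟩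
  obtain ⟨i, hi⟩ := hS (Sum.inl y)
  refine ⟨i, ?_, fun s hs => ?_⟩
  · have : i ∈ S.image c' := hcS ▸ Finset.mem_univ i
    obtain ⟨x, hx, hxi⟩ := Finset.mem_image.1 this
    rcases x with t | j
    · exact Finset.mem_image.2 ⟨t, by simpa using hx, hxi⟩
    · have hji : j = i := hxi
      have := hi _ hx
      rw [hji, hφl, hφr] at this
      omega
  · have := hi (Sum.inl s) (Finset.mem_filter.1 hs).2
    rw [hφl, hφl] at this
    omega

/-! ### From Scarf's lemma to maps of the simplex -/

/-- A discrete fixed point lemma on the grid of points of the simplex with denominator `N`. -/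
theorem exists_grid_point_near_colors {I : Type*} [Fintype I] [Nonempty I] (N : ℕ)
    (c : (I → ℕ) → I) :
    ∃ q : I → ℕ, ∑ i, q i = N ∧ ∀ i, q i = 0 ∨ ∃ s : I → ℕ, ∑ i, s i = N ∧ c s = i ∧
      ∀ j, s j ≤ q j + Fintype.card I ∧ q j ≤ s j + Fintype.card I := by
  classical
  let T := {x : I → ℕ // x ∈ Finset.piAntidiag Finset.univ N}
  let : Fintype T := inferInstanceAs (Fintype {x : I → ℕ // x ∈ Finset.piAntidiag Finset.univ N})
  have hT : ∀ x : T, ∑ i, x.1 i = N := fun x => (Finset.mem_piAntidiag.1 x.2).1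
  have hmk : ∀ x : I → ℕ, ∑ i, x i = N → x ∈ Finset.piAntidiag Finset.univ N := fun x hx =>
    Finset.mem_piAntidiag.2 ⟨hx, fun _ _ => Finset.mem_univ _⟩
  have : Nonempty T := by
    obtain ⟨i⟩ := ‹Nonempty I›
    exact ⟨⟨Pi.single i N, hmk _ (by simp)⟩⟩
  let e := Fintype.equivFin T
  -- Order by the `i`-th coordinate, with ties broken by `e`.
  let ψ : I → T → ℕ := fun i x => x.1 i * Fintype.card T + e x
  have hψle : ∀ i x y, ψ i x ≤ ψ i y → x.1 i ≤ y.1 i := by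
    intro i x y h
    by_contra! hlt
    have h1 := Nat.mul_le_mul_right (Fintype.card T) (Nat.succ_le_of_lt hlt)
    have h2 := (e y).2
    simp only [ψ] at h
    rw [Nat.succ_mul] at h1
    omega
  have hψ : ∀ i, Function.Injective (ψ i) := by
    intro i x y h
    have h1 := le_antisymm (hψle i x y h.le) (hψle i y x h.ge)
    simp only [ψ, h1] at h
    exact e.injective (Fin.ext (by omega))
  obtain ⟨σ, hσ⟩ := exists_dominant_image ψ hψ (fun x => c x.1)
  set C := σ.image fun x => c x.1 with hC
  obtain ⟨i₁, hi₁, -⟩ := hσ (Classical.arbitrary T)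
  obtain ⟨s₁, hs₁, -⟩ := Finset.mem_image.1 hi₁
  choose m hmσ hm using fun i => σ.exists_min_image (fun s => s.1 i) ⟨s₁, hs₁⟩
  have hle : ∀ s ∈ σ, ∑ i ∈ C, (m i).1 i ≤ ∑ i ∈ C, s.1 i := fun s hs =>
    Finset.sum_le_sum fun i _ => hm i s hs
  have hsum : ∀ s : T, ∑ i ∈ C, s.1 i + ∑ i ∈ Finset.univ \ C, s.1 i = N := fun s => by
    rw [add_comm, Finset.sum_sdiff (Finset.subset_univ C), hT]
  have hbuild : ∀ (f : I → ℕ) (r : ℕ), ∑ i ∈ C, f i + r = N →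
      ∑ i, ((if i ∈ C then f i else 0) + if i = i₁ then r else 0) = N := by
    intro f r h
    rw [Finset.sum_add_distrib]
    simpa using h
  -- Otherwise some grid point strictly exceeds all the minima `m i` with `i ∈ C`, against
  -- dominance.
  have hbig : N < ∑ i ∈ C, (m i).1 i + C.card := by
    by_contra! h
    obtain ⟨r, hr⟩ := Nat.exists_eq_add_of_le h
    have h1 : ∑ i ∈ C, ((m i).1 i + 1) + r = N := by
      rw [Finset.sum_add_distrib]; simp only [Finset.sum_const, smul_eq_mul, mul_one]; omega
    obtain ⟨i, hi, h2⟩ := hσ ⟨_, hmk _ (hbuild _ r h1)⟩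
    have h3 := hψle _ _ _ (h2 (m i) (hmσ i))
    simp only [hi, if_true] at h3
    omega
  have hcard : C.card ≤ Fintype.card I := Finset.card_le_univ C
  have h1 := hle s₁ hs₁
  have h2 := hsum s₁
  obtain ⟨r, hr⟩ : ∃ r, ∑ i ∈ C, (m i).1 i + r = N := ⟨N - ∑ i ∈ C, (m i).1 i, by omega⟩
  -- The point `q` has the minima on `C` and 0 elsewhere, with the surplus `r < C.card` placed at
  -- `i₁`. Members of `σ` dominate the minima on `C` and have the same total, so they differ from
  -- `q` by at most `Fintype.card I` in each coordinate.
  refine ⟨_, hbuild _ r hr, fun i => ?_⟩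
  by_cases hi : i ∈ C
  swap
  · left
    have : i ≠ i₁ := fun h => hi (h ▸ hi₁)
    simp [hi, this]
  right
  obtain ⟨s, hs, hsi⟩ := Finset.mem_image.1 hi
  refine ⟨s.1, hT s, hsi, fun j => ?_⟩
  have h3 := hsum s
  have h4 := hle s hs
  by_cases hj : j ∈ C
  · have h5 := hm j s hs
    have h6 : ∑ i ∈ C.erase j, (m i).1 i ≤ ∑ i ∈ C.erase j, s.1 i :=
      Finset.sum_le_sum fun i _ => hm i s hs
    have h7 := Finset.add_sum_erase C (fun i => (m i).1 i) hj
    have h8 := Finset.add_sum_erase C (fun i => s.1 i) hj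
    simp only [hj, if_true]
    beta_reduce at h5 h7 h8
    split_ifs <;> omega
  · have h5 := Finset.single_le_sum (f := s.1) (s := Finset.univ \ C)
      (fun _ _ => Nat.zero_le _) (by simpa using hj)
    have : j ≠ i₁ := fun h => hj (h ▸ hi₁)
    simp only [hj, this, if_false]
    omega

/-- A continuous self-map of the simplex that maps each face to itself takes the barycentre as a
value. -/
theorem exists_le_inv_card_of_continuousOn {I : Type*} [Fintype I] [Nonempty I]
    (g : (I → ℝ) → I → ℝ) (hg : ContinuousOn g (stdSimplex ℝ I))
    (hsum : ∀ x ∈ stdSimplex ℝ I, ∑ i, g x i = 1)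
    (hface : ∀ x ∈ stdSimplex ℝ I, ∀ i, x i = 0 → g x i = 0) :
    ∃ x ∈ stdSimplex ℝ I, ∀ i, g x i ≤ (Fintype.card I : ℝ)⁻¹ := by
  classical
  set n := Fintype.card I with hn
  have hn0 : 0 < n := Fintype.card_pos
  have hne : (stdSimplex ℝ I).Nonempty := by
    obtain ⟨i⟩ := ‹Nonempty I›
    exact ⟨_, single_mem_stdSimplex ℝ i⟩
  have hcpt := isCompact_stdSimplex ℝ I
  have huc := hcpt.uniformContinuousOn_of_continuous hg
  have happrox : ∀ ε > 0, ∃ x ∈ stdSimplex ℝ I, ∀ i, g x i ≤ (n : ℝ)⁻¹ + ε := by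
    intro ε hε
    obtain ⟨δ, hδ, hδ'⟩ := Metric.uniformContinuousOn_iff.1 huc ε hε
    obtain ⟨N, hN⟩ := exists_nat_gt (n / δ)
    have hN0 : (0 : ℝ) < N := lt_of_le_of_lt (by positivity) hN
    let p : (I → ℕ) → I → ℝ := fun s i => s i / N
    have hp : ∀ s : I → ℕ, ∑ i, s i = N → p s ∈ stdSimplex ℝ I := by
      intro s hs
      refine ⟨fun i => by positivity, ?_⟩
      simp only [p]
      rw [← Finset.sum_div, ← Nat.cast_sum, hs, div_self hN0.ne']
    -- Colour a grid point by a coordinate of `g` that is at most the average.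
    have hcol : ∀ s : I → ℕ, ∃ i, ∑ i, s i = N → g (p s) i ≤ (n : ℝ)⁻¹ := by
      intro s
      by_cases hs : ∑ i, s i = N
      · by_contra! h
        have h1 := Finset.sum_lt_sum_of_nonempty (Finset.univ_nonempty (α := I))
          (fun i _ => (h i).2)
        rw [hsum _ (hp s hs)] at h1
        simp only [Finset.sum_const, Finset.card_univ, ← hn, nsmul_eq_mul] at h1
        rw [mul_inv_cancel₀ (by positivity)] at h1
        exact lt_irrefl _ h1
      · exact ⟨Classical.arbitrary I, fun h => absurd h hs⟩
    choose c hc using hcol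
    obtain ⟨q, hq, hq'⟩ := exists_grid_point_near_colors N c
    refine ⟨p q, hp q hq, fun i => ?_⟩
    rcases hq' i with h0 | ⟨s, hs, rfl, hsq⟩
    · rw [hface _ (hp q hq) i (by simp [p, h0])]
      positivity
    · have h1 : dist (p q) (p s) < δ := by
        rw [dist_pi_lt_iff hδ]
        intro j
        obtain ⟨h2, h3⟩ := hsq j
        have h2' : (s j : ℝ) ≤ q j + n := by exact_mod_cast h2
        have h3' : (q j : ℝ) ≤ s j + n := by exact_mod_cast h3
        rw [Real.dist_eq, ← sub_div, abs_div, abs_of_pos hN0, div_lt_iff₀ hN0]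
        rw [div_lt_iff₀ hδ] at hN
        have : |(q j : ℝ) - s j| ≤ n := abs_le.2 ⟨by linarith, by linarith⟩
        linarith
      have h2 := hδ' _ (hp q hq) _ (hp s hs) h1
      have h3 := (dist_le_pi_dist (g (p q)) (g (p s)) (c s)).trans_lt h2
      rw [Real.dist_eq, abs_lt] at h3
      have := hc s hs
      linarith
  obtain ⟨x, hx, hxmin⟩ := hcpt.exists_isMinOn hne
    (f := fun x => Finset.univ.sup' Finset.univ_nonempty (g x))
    (ContinuousOn.finset_sup'_apply _ fun i _ => (continuous_apply i).comp_continuousOn hg)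
  refine ⟨x, hx, fun i => le_of_forall_pos_le_add fun ε hε => ?_⟩
  obtain ⟨y, hy, hy'⟩ := happrox ε hε
  calc g x i ≤ Finset.univ.sup' Finset.univ_nonempty (g x) :=
        Finset.le_sup' (g x) (Finset.mem_univ i)
    _ ≤ Finset.univ.sup' Finset.univ_nonempty (g y) := hxmin hy
    _ ≤ _ := Finset.sup'_le _ _ fun j _ => hy' j
-- Envy-free choice on the simplex
open Filter Topology

/-- A system of preferences with weights in which no index `k` is overloaded has, for every
`k`, a matching that avoids `k`. -/
theorem exists_injective_avoiding {I ι : Type*} [Fintype I] [Fintype ι]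
    (hcard : Fintype.card ι + 1 = Fintype.card I) (w : ι → I → ℝ) (hw : ∀ i k, 0 ≤ w i k)
    (hrow : ∀ i, ∑ k, w i k = 1) (hcol : ∀ k, ∑ i, w i k ≤ Fintype.card ι / Fintype.card I) (k : I) :
    ∃ π : ι → I, Function.Injective π ∧ ∀ i, π i ≠ k ∧ 0 < w i (π i) := by
  classical
  let t : ι → Finset I := fun i => Finset.univ.filter fun j => j ≠ k ∧ 0 < w i j
  obtain ⟨π, hπ, h⟩ := (Finset.all_card_le_biUnion_card_iff_exists_injective t).1 (by
    intro S
    rcases S.eq_empty_or_nonempty with rfl | hS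
    · simp
    set N := S.biUnion t with hN
    have hI : (0 : ℝ) < Fintype.card I := by
      have : 0 < Fintype.card I := by omega
      exact_mod_cast this
    have hI' : (Fintype.card ι : ℝ) + 1 = Fintype.card I := by exact_mod_cast hcard
    -- Hall's condition: the weight `S.card` of the rows in `S` sits in the columns `insert k N`,
    -- each of which holds less than 1.
    have h1 : (S.card : ℝ) ≤ (N.card + 1) * (Fintype.card ι / Fintype.card I) := by
      calc (S.card : ℝ) = ∑ i ∈ S, ∑ j, w i j := by simp [hrow]
        _ = ∑ i ∈ S, ∑ j ∈ insert k N, w i j := by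
            refine Finset.sum_congr rfl fun i hi => (Finset.sum_subset (Finset.subset_univ _) ?_).symm
            intro j _ hj
            refine le_antisymm (not_lt.1 fun hlt => hj ?_) (hw i j)
            by_cases hjk : j = k
            · exact hjk ▸ Finset.mem_insert_self _ _
            · exact Finset.mem_insert_of_mem (Finset.mem_biUnion.2 ⟨i, hi, by simp [t, hjk, hlt]⟩)
        _ = ∑ j ∈ insert k N, ∑ i ∈ S, w i j := Finset.sum_comm
        _ ≤ ∑ j ∈ insert k N, (Fintype.card ι / Fintype.card I : ℝ) :=
            Finset.sum_le_sum fun j _ => (Finset.sum_le_sum_of_subset_of_nonneg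
              (Finset.subset_univ S) fun i _ _ => hw i j).trans (hcol j)
        _ = (N.card + 1) * (Fintype.card ι / Fintype.card I) := by
            rw [Finset.sum_const, Finset.card_insert_of_notMem (by simp [hN, t]), nsmul_eq_mul]
            push_cast
            ring
    have hSpos : (0 : ℝ) < S.card := by exact_mod_cast hS.card_pos
    have h2 : (S.card : ℝ) < N.card + 1 := by
      refine h1.trans_lt ?_
      have : (Fintype.card ι : ℝ) / Fintype.card I < 1 := by
        rw [div_lt_one hI]; linarith
      nlinarith [(Nat.cast_nonneg N.card : (0 : ℝ) ≤ N.card)]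
    have h3 : S.card < N.card + 1 := by exact_mod_cast h2
    omega)
  exact ⟨π, hπ, fun i => by simpa [t] using h i⟩

/-- Weights proportional to `f` are supported on pieces within `ε` of the best, so a matching along
positive weights is almost envy-free. -/
theorem exists_approx_envyFree {I ι : Type*} [Fintype I] [Fintype ι]
    (hcard : Fintype.card ι + 1 = Fintype.card I) (u : ι → I → (I → ℝ) → ℝ)
    (hu : ∀ i k, ContinuousOn (u i k) (stdSimplex ℝ I)) (s : ι → ℝ) (hs : ∀ i, 0 < s i)
    (hsum : ∀ i, ∀ x ∈ stdSimplex ℝ I, s i ≤ ∑ k, u i k x)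
    (hface : ∀ i k, ∀ x ∈ stdSimplex ℝ I, x k = 0 → u i k x ≤ 0) {ε : ℝ} (hε : 0 < ε) :
    ∃ x ∈ stdSimplex ℝ I, ∀ k, ∃ π : ι → I, Function.Injective π ∧
      ∀ i, π i ≠ k ∧ ∀ j, u i j x ≤ u i (π i) x + ε := by
  classical
  have hI : 0 < Fintype.card I := by omega
  have : Nonempty I := Fintype.card_pos_iff.1 hI
  rcases isEmpty_or_nonempty ι with hι | hι
  · exact ⟨_, single_mem_stdSimplex ℝ (Classical.arbitrary I), fun k =>
      ⟨fun i => isEmptyElim i, fun i => isEmptyElim i, fun i => isEmptyElim i⟩⟩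
  have hIR : (0 : ℝ) < Fintype.card I := by exact_mod_cast hI
  have hιR : (0 : ℝ) < Fintype.card ι := by exact_mod_cast Fintype.card_pos
  let M : ι → (I → ℝ) → ℝ := fun i x => Finset.univ.sup' Finset.univ_nonempty fun k => u i k x
  have hM : ∀ i k x, u i k x ≤ M i x := fun i k x =>
    Finset.le_sup' (fun k => u i k x) (Finset.mem_univ k)
  -- The bound `s i / Fintype.card I` is at most the best utility, so a piece with zero coordinate
  -- receives no weight and faces are preserved.
  let δ : ι → ℝ := fun i => min ε (s i / Fintype.card I)
  have hδ : ∀ i, 0 < δ i := fun i => lt_min hε (div_pos (hs i) hIR)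
  have hMδ : ∀ i, ∀ x ∈ stdSimplex ℝ I, δ i ≤ M i x := by
    intro i x hx
    refine (min_le_right _ _).trans ?_
    rw [div_le_iff₀ hIR]
    calc s i ≤ ∑ k, u i k x := hsum i x hx
      _ ≤ ∑ k : I, M i x := Finset.sum_le_sum fun k _ => hM i k x
      _ = M i x * Fintype.card I := by simp [mul_comm]
  let f : ι → I → (I → ℝ) → ℝ := fun i k x => max 0 (u i k x - M i x + δ i)
  have hf : ∀ i k x, 0 ≤ f i k x := fun i k x => le_max_left _ _
  have hD : ∀ i x, 0 < ∑ k, f i k x := by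
    intro i x
    obtain ⟨k, -, hk⟩ := Finset.exists_mem_eq_sup' Finset.univ_nonempty fun k => u i k x
    refine Finset.sum_pos' (fun k _ => hf i k x) ⟨k, Finset.mem_univ k, lt_max_of_lt_right ?_⟩
    have hk' : M i x = u i k x := hk
    rw [hk', sub_self, zero_add]
    exact hδ i
  have hMc : ∀ i, ContinuousOn (M i) (stdSimplex ℝ I) := fun i =>
    ContinuousOn.finset_sup'_apply _ fun k _ => hu i k
  have hfc : ∀ i k, ContinuousOn (f i k) (stdSimplex ℝ I) := fun i k =>
    continuousOn_const.sup (((hu i k).sub (hMc i)).add continuousOn_const)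
  let w : (I → ℝ) → ι → I → ℝ := fun x i k => f i k x / ∑ k, f i k x
  have hrow : ∀ x i, ∑ k, w x i k = 1 := fun x i => by
    simp only [w]
    rw [← Finset.sum_div, div_self (hD i x).ne']
  obtain ⟨x, hx, hxle⟩ := exists_le_inv_card_of_continuousOn
    (fun x k => (∑ i, w x i k) / Fintype.card ι)
    (continuousOn_pi.2 fun k => (continuousOn_finsetSum _ fun i _ =>
      (hfc i k).div (continuousOn_finsetSum _ fun k _ => hfc i k) fun x _ => (hD i x).ne').div_const _)
    (fun x _ => by
      rw [← Finset.sum_div, Finset.sum_comm]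
      simp only [hrow]
      simp [hιR.ne'])
    (fun x hx k hk => by
      have : ∀ i, w x i k = 0 := fun i => by
        have h1 := hMδ i x hx
        have h2 := hface i k x hx hk
        have : f i k x = 0 := max_eq_left (by linarith)
        simp only [w, this, zero_div]
      simp [this])
  refine ⟨x, hx, fun k => ?_⟩
  obtain ⟨π, hπ, h⟩ := exists_injective_avoiding hcard (w x)
    (fun i k => div_nonneg (hf i k x) (hD i x).le) (hrow x)
    (fun k => by
      have := hxle k
      rw [div_le_iff₀ hιR] at this
      rwa [div_eq_inv_mul]) k
  refine ⟨π, hπ, fun i => ⟨(h i).1, fun j => ?_⟩⟩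
  have h1 : 0 < f i (π i) x := by
    by_contra h0
    have h0' : f i (π i) x = 0 := le_antisymm (not_lt.1 h0) (hf i _ x)
    have := (h i).2
    simp only [w, h0', zero_div] at this
    exact lt_irrefl _ this
  have h2 : 0 < u i (π i) x - M i x + δ i := by
    rcases lt_max_iff.1 h1 with h | h
    · exact absurd h (lt_irrefl _)
    · exact h
  have h3 := hM i j x
  have h4 : δ i ≤ ε := min_le_left _ _
  linarith

/-- Envy-free selection with one secretive agent: for continuous utilities on the simplex there is
a point at which, for each `k`, the agents other than the secretive one can be matched without envy
to the indices other than `k`. -/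
theorem exists_envyFree {I ι : Type*} [Fintype I] [Fintype ι]
    (hcard : Fintype.card ι + 1 = Fintype.card I) (u : ι → I → (I → ℝ) → ℝ)
    (hu : ∀ i k, ContinuousOn (u i k) (stdSimplex ℝ I)) (s : ι → ℝ) (hs : ∀ i, 0 < s i)
    (hsum : ∀ i, ∀ x ∈ stdSimplex ℝ I, s i ≤ ∑ k, u i k x)
    (hface : ∀ i k, ∀ x ∈ stdSimplex ℝ I, x k = 0 → u i k x ≤ 0) :
    ∃ x ∈ stdSimplex ℝ I, ∀ k, ∃ π : ι → I, Function.Injective π ∧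
      ∀ i, π i ≠ k ∧ ∀ j, u i j x ≤ u i (π i) x := by
  classical
  choose x hx hπ using fun m : ℕ => exists_approx_envyFree hcard u hu s hs hsum hface
    (Nat.one_div_pos_of_nat (α := ℝ) (n := m))
  obtain ⟨a, ha, φ, hφ, hlim⟩ := (isCompact_stdSimplex ℝ I).tendsto_subseq hx
  refine ⟨a, ha, fun k => ?_⟩
  by_contra! hcon
  have hlim' : Tendsto (x ∘ φ) atTop (𝓝[stdSimplex ℝ I] a) :=
    tendsto_nhdsWithin_iff.2 ⟨hlim, Eventually.of_forall fun m => hx _⟩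
  have hul : ∀ i k, Tendsto (fun m => u i k (x (φ m))) atTop (𝓝 (u i k a)) := fun i k =>
    (hu i k a ha).tendsto.comp hlim'
  have hε : Tendsto (fun m => 1 / ((φ m : ℝ) + 1)) atTop (𝓝 0) :=
    tendsto_one_div_add_atTop_nhds_zero_nat.comp hφ.tendsto_atTop
  -- There are finitely many `π`; if each fails in the limit, all fail simultaneously far along the
  -- subsequence.
  have hev : ∀ π : ι → I, ∀ᶠ m in atTop, ¬ (Function.Injective π ∧
      ∀ i, π i ≠ k ∧ ∀ j, u i j (x (φ m)) ≤ u i (π i) (x (φ m)) + 1 / ((φ m : ℝ) + 1)) := by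
    intro π
    by_cases hinj : Function.Injective π
    swap
    · exact Eventually.of_forall fun m h => hinj h.1
    obtain ⟨i, hi⟩ := hcon π hinj
    by_cases hik : π i = k
    · exact Eventually.of_forall fun m h => (h.2 i).1 hik
    obtain ⟨j, hj⟩ := hi hik
    have := ((hul i (π i)).add hε).eventually_lt (hul i j) (by simpa using hj)
    exact this.mono fun m hm h => absurd ((h.2 i).2 j) (not_le.2 hm)
  obtain ⟨m, hm⟩ := (eventually_all.2 hev).exists
  obtain ⟨π, h⟩ := hπ (φ m) k
  exact hm π h

/-! ### Parametrizing nested hyperplane partitions -/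

theorem measurable_halfSpaceGE {d : ℕ} (β : EReal) (v : EuclideanSpace ℝ (Fin d)) :
    MeasurableSet (halfSpaceGE β v) := by
  unfold halfSpaceGE
  exact measurableSet_le measurable_const (by fun_prop)

theorem measurable_halfSpaceLE {d : ℕ} (β : EReal) (v : EuclideanSpace ℝ (Fin d)) :
    MeasurableSet (halfSpaceLE β v) := by
  unfold halfSpaceLE
  exact measurableSet_le (by fun_prop) measurable_const

theorem ae_inner_ne {d : ℕ} {v : EuclideanSpace ℝ (Fin d)} (hv : ‖v‖ = 1) (β : EReal) :
    ∀ᵐ y ∂(volume : Measure (EuclideanSpace ℝ (Fin d))), ((inner ℝ y v : ℝ) : EReal) ≠ β := by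
  have hvv : inner ℝ v v = (1 : ℝ) := by rw [real_inner_self_eq_norm_sq, hv]; norm_num
  induction β with
  | bot => exact Eventually.of_forall fun y => EReal.coe_ne_bot _
  | top => exact Eventually.of_forall fun y => EReal.coe_ne_top _
  | coe b =>
    let s : AffineSubspace ℝ (EuclideanSpace ℝ (Fin d)) :=
      AffineSubspace.mk' (b • v) (LinearMap.ker (innerₛₗ ℝ v))
    have hs : s ≠ ⊤ := by
      intro h
      have h1 : (b + 1) • v ∈ s := h ▸ AffineSubspace.mem_top ℝ _ _
      rw [AffineSubspace.mem_mk', vsub_eq_sub, ← sub_smul, LinearMap.mem_ker] at h1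
      simp [innerₛₗ_apply_apply, hv] at h1
    have h0 := Measure.addHaar_affineSubspace volume s hs
    rw [ae_iff]
    refine measure_mono_null (fun y hy => ?_) h0
    simp only [ne_eq, not_not, Set.mem_ofPred_eq, EReal.coe_eq_coe_iff] at hy
    change y ∈ s
    rw [AffineSubspace.mem_mk', vsub_eq_sub, LinearMap.mem_ker, innerₛₗ_apply_apply,
      inner_sub_right, inner_smul_right, real_inner_comm, hy, hvv]
    ring

/-- The position of the hyperplane of a join: it moves from `⊥` to `⊤` as the ratio of `b` to `a`
grows from `0` to `∞`. -/
noncomputable def cutPosition (a b : ℝ) : EReal :=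
  ENNReal.log (ENNReal.ofReal b / ENNReal.ofReal a)

theorem cutPosition_zero_right (a : ℝ) : cutPosition a 0 = ⊥ := by
  simp [cutPosition]

theorem cutPosition_zero_left {b : ℝ} (hb : 0 < b) : cutPosition 0 b = ⊤ := by
  simp [cutPosition, ENNReal.div_zero, hb]

/-- The ratio is continuous in `[0, ∞]` away from `0 / 0`. -/
theorem tendsto_cutPosition {X : Type*} {l : Filter X} {f g : X → ℝ} {a b : ℝ}
    (hf : Tendsto f l (𝓝 a)) (hg : Tendsto g l (𝓝 b)) (h : 0 < a ∨ 0 < b) :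
    Tendsto (fun x => cutPosition (f x) (g x)) l (𝓝 (cutPosition a b)) := by
  refine (ENNReal.continuous_log.tendsto _).comp ?_
  refine ENNReal.Tendsto.div (ENNReal.tendsto_ofReal hg) ?_ (ENNReal.tendsto_ofReal hf)
    (Or.inl ENNReal.ofReal_ne_top)
  rcases h with h | h
  · exact Or.inr (by simpa using h)
  · exact Or.inl (by simpa using h)

/-- A parametrization of a space of partitions by the punctured nonnegative orthant, continuous in
the sense of almost everywhere convergence. -/
structure IsOrthantParametrization {d n : ℕ} (A : Set (Fin n → Set (EuclideanSpace ℝ (Fin d))))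
    (P : (Fin n → ℝ) → Fin n → Set (EuclideanSpace ℝ (Fin d))) : Prop where
  mem : ∀ x, P x ∈ A
  measurableSet : ∀ x k, MeasurableSet (P x k)
  exists_mem : ∀ x, 0 ≤ x → x ≠ 0 → ∀ y, ∃ k, y ∈ P x k
  eq_empty : ∀ x, 0 ≤ x → x ≠ 0 → ∀ k, x k = 0 → P x k = ∅
  ae_eventually : ∀ x, 0 ≤ x → x ≠ 0 → ∀ k,
    ∀ᵐ y ∂(volume : Measure (EuclideanSpace ℝ (Fin d))),
      ∀ᶠ z in 𝓝[{z | 0 ≤ z}] x, y ∈ P z k ↔ y ∈ P x k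

theorem sum_pos_of_nonneg_of_ne_zero {I : Type*} [Fintype I] {x : I → ℝ} (hx : 0 ≤ x)
    (h : x ≠ 0) : 0 < ∑ i, x i := by
  obtain ⟨i, hi⟩ := Function.ne_iff.1 h
  exact Finset.sum_pos' (fun i _ => hx i) ⟨i, Finset.mem_univ i, lt_of_le_of_ne (hx i) (Ne.symm hi)⟩

/-- On one side of a moving hyperplane, a.e. convergence is preserved. -/
theorem eventually_mem_inter_iff {X E : Type*} {l : Filter X} {Q H : X → Set E} {Q₀ H₀ : Set E}
    {y : E} (hQ : y ∈ H₀ → ∀ᶠ z in l, y ∈ Q z ↔ y ∈ Q₀) (hH : ∀ᶠ z in l, y ∈ H z ↔ y ∈ H₀) :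
    ∀ᶠ z in l, y ∈ Q z ∩ H z ↔ y ∈ Q₀ ∩ H₀ := by
  by_cases h : y ∈ H₀
  · filter_upwards [hQ h, hH] with z h1 h2
    rw [Set.mem_inter_iff, Set.mem_inter_iff, h1, h2]
  · filter_upwards [hH] with z h2
    rw [Set.mem_inter_iff, Set.mem_inter_iff, h2]
    tauto

/-- By induction, a join splits the coordinates into two blocks, which parametrize the two sides,
while the ratio of their sums places the cut. Using the orthant avoids normalizing the blocks. -/
theorem IsNestedHyperplaneSpace.exists_isOrthantParametrization {d n : ℕ}
    {A : Set (Fin n → Set (EuclideanSpace ℝ (Fin d)))} (hA : IsNestedHyperplaneSpace n A) :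
    ∃ P, IsOrthantParametrization A P := by
  induction hA with
  | trivial =>
    refine ⟨fun _ _ => Set.univ, fun _ => rfl, fun _ _ => MeasurableSet.univ,
      fun _ _ _ _ => ⟨0, Set.mem_univ _⟩, fun x _ hx k hk => ?_, fun _ _ _ _ => ?_⟩
    · exact absurd (funext fun i => by rw [Subsingleton.elim i k, hk]; rfl) hx
    · exact Eventually.of_forall fun _ => Eventually.of_forall fun _ => Iff.rfl
  | @join n m A B v hv _ _ ihA ihB =>
    obtain ⟨P, hP⟩ := ihA
    obtain ⟨Q, hQ⟩ := ihB
    let l : (Fin (n + m) → ℝ) → Fin n → ℝ := fun x i => x (Fin.castAdd m i)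
    let r : (Fin (n + m) → ℝ) → Fin m → ℝ := fun x i => x (Fin.natAdd n i)
    have hl : ∀ x, 0 ≤ x → 0 ≤ l x := fun x hx i => hx _
    have hr : ∀ x, 0 ≤ x → 0 ≤ r x := fun x hx i => hx _
    have hlc : Continuous l := by fun_prop
    have hrc : Continuous r := by fun_prop
    let β : (Fin (n + m) → ℝ) → EReal := fun x => cutPosition (∑ i, l x i) (∑ i, r x i)
    have hlr : ∀ x, l x = 0 → r x = 0 → x = 0 := by
      intro x h1 h2
      funext i
      induction i using Fin.addCases with
      | left i => exact congrFun h1 i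
      | right i => exact congrFun h2 i
    have hl0 : ∀ x, 0 ≤ x → x ≠ 0 → l x = 0 → β x = ⊤ := by
      intro x hx hx0 h
      have := sum_pos_of_nonneg_of_ne_zero (hr x hx) fun h' => hx0 (hlr x h h')
      simp only [β, h, Pi.zero_apply, Finset.sum_const_zero]
      exact cutPosition_zero_left this
    have hr0 : ∀ x, r x = 0 → β x = ⊥ := by
      intro x h
      simp only [β, h, Pi.zero_apply, Finset.sum_const_zero]
      exact cutPosition_zero_right _
    have hGE : ∀ x, 0 ≤ x → x ≠ 0 → ∀ y, y ∈ halfSpaceGE (β x) v → l x ≠ 0 := by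
      intro x hx hx0 y hy h
      rw [hl0 x hx hx0 h, halfSpaceGE, Set.mem_ofPred_eq, top_le_iff] at hy
      exact EReal.coe_ne_top _ hy
    have hLE : ∀ x y, y ∈ halfSpaceLE (β x) v → r x ≠ 0 := by
      intro x y hy h
      rw [hr0 x h, halfSpaceLE, Set.mem_ofPred_eq, le_bot_iff] at hy
      exact EReal.coe_ne_bot _ hy
    have hβ : ∀ x, 0 ≤ x → x ≠ 0 → Tendsto β (𝓝[{z | 0 ≤ z}] x) (𝓝 (β x)) := by
      intro x hx hx0
      refine tendsto_cutPosition (Continuous.tendsto' (by fun_prop) _ _ rfl |>.mono_left nhdsWithin_le_nhds)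
        (Continuous.tendsto' (by fun_prop) _ _ rfl |>.mono_left nhdsWithin_le_nhds) ?_
      by_cases h : l x = 0
      · exact Or.inr (sum_pos_of_nonneg_of_ne_zero (hr x hx) fun h' => hx0 (hlr x h h'))
      · exact Or.inl (sum_pos_of_nonneg_of_ne_zero (hl x hx) h)
    have hlt : ∀ x, Tendsto l (𝓝[{z | 0 ≤ z}] x) (𝓝[{z | 0 ≤ z}] (l x)) := fun x =>
      hlc.continuousWithinAt.tendsto_nhdsWithin fun z hz => hl z hz
    have hrt : ∀ x, Tendsto r (𝓝[{z | 0 ≤ z}] x) (𝓝[{z | 0 ≤ z}] (r x)) := fun x =>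
      hrc.continuousWithinAt.tendsto_nhdsWithin fun z hz => hr z hz
    refine ⟨fun x => Fin.append (fun j => P (l x) j ∩ halfSpaceGE (β x) v)
      (fun k => Q (r x) k ∩ halfSpaceLE (β x) v), ?_, ?_, ?_, ?_, ?_⟩
    · exact fun x => ⟨P (l x), hP.mem _, Q (r x), hQ.mem _, β x, rfl⟩
    · intro x k
      induction k using Fin.addCases with
      | left k =>
        rw [Fin.append_left]
        exact (hP.measurableSet _ _).inter (measurable_halfSpaceGE _ _)
      | right k =>
        rw [Fin.append_right]
        exact (hQ.measurableSet _ _).inter (measurable_halfSpaceLE _ _)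
    · intro x hx hx0 y
      rcases le_total (β x) ((inner ℝ y v : ℝ) : EReal) with h | h
      · obtain ⟨k, hk⟩ := hP.exists_mem _ (hl x hx) (hGE x hx hx0 y h) y
        exact ⟨Fin.castAdd m k, by rw [Fin.append_left]; exact ⟨hk, h⟩⟩
      · obtain ⟨k, hk⟩ := hQ.exists_mem _ (hr x hx) (hLE x y h) y
        exact ⟨Fin.natAdd n k, by rw [Fin.append_right]; exact ⟨hk, h⟩⟩
    · intro x hx hx0 k hk
      rw [Set.eq_empty_iff_forall_notMem]
      intro y hy
      induction k using Fin.addCases with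
      | left k =>
        rw [Fin.append_left] at hy
        have := hP.eq_empty _ (hl x hx) (hGE x hx hx0 y hy.2) k hk
        exact Set.notMem_empty y (this ▸ hy.1)
      | right k =>
        rw [Fin.append_right] at hy
        have := hQ.eq_empty _ (hr x hx) (hLE x y hy.2) k hk
        exact Set.notMem_empty y (this ▸ hy.1)
    · intro x hx hx0 k
      have hcut : ∀ᵐ y ∂(volume : Measure (EuclideanSpace ℝ (Fin d))),
          (∀ᶠ z in 𝓝[{z | 0 ≤ z}] x, y ∈ halfSpaceGE (β z) v ↔ y ∈ halfSpaceGE (β x) v) ∧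
          (∀ᶠ z in 𝓝[{z | 0 ≤ z}] x, y ∈ halfSpaceLE (β z) v ↔ y ∈ halfSpaceLE (β x) v) := by
        -- A point off the limiting hyperplane stays on its side under small moves of the cut.
        filter_upwards [ae_inner_ne hv (β x)] with y hy
        simp only [halfSpaceGE, halfSpaceLE, Set.mem_ofPred_eq]
        rcases lt_or_gt_of_ne hy with h | h
        · have := (hβ x hx hx0).eventually (lt_mem_nhds h)
          exact ⟨this.mono fun z hz => iff_of_false hz.not_ge h.not_ge,
            this.mono fun z hz => iff_of_true hz.le h.le⟩
        · have := (hβ x hx hx0).eventually (gt_mem_nhds h)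
          exact ⟨this.mono fun z hz => iff_of_true hz.le h.le,
            this.mono fun z hz => iff_of_false hz.not_ge h.not_ge⟩
      induction k using Fin.addCases with
      | left k =>
        simp only [Fin.append_left]
        -- Nothing is known about `P` near the origin, but there the cut is at `⊤` and its side is
        -- empty.
        by_cases h : l x = 0
        · filter_upwards [hcut] with y hy
          exact eventually_mem_inter_iff (fun h' => absurd h (hGE x hx hx0 y h')) hy.1
        · filter_upwards [hcut, hP.ae_eventually _ (hl x hx) h k] with y hy hy'
          exact eventually_mem_inter_iff (fun _ => (hlt x).eventually hy') hy.1
      | right k =>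
        simp only [Fin.append_right]
        by_cases h : r x = 0
        · filter_upwards [hcut] with y hy
          exact eventually_mem_inter_iff (fun h' => absurd h (hLE x y h')) hy.2
        · filter_upwards [hcut, hQ.ae_eventually _ (hr x hx) h k] with y hy hy'
          exact eventually_mem_inter_iff (fun _ => (hrt x).eventually hy') hy.2

/-! ### Measures of the pieces and the assignment -/

theorem ne_zero_of_mem_stdSimplex {I : Type*} [Fintype I] {x : I → ℝ}
    (hx : x ∈ stdSimplex ℝ I) : x ≠ 0 := by
  rintro rfl
  have := hx.2
  simp at this

theorem IsOrthantParametrization.continuousOn_measureReal {d n : ℕ}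
    {A : Set (Fin n → Set (EuclideanSpace ℝ (Fin d)))}
    {P : (Fin n → ℝ) → Fin n → Set (EuclideanSpace ℝ (Fin d))} (hP : IsOrthantParametrization A P)
    (μ : Measure (EuclideanSpace ℝ (Fin d))) [IsFiniteMeasure μ] (hμ : μ ≪ volume) (k : Fin n) :
    ContinuousOn (fun x => μ.real (P x k)) (stdSimplex ℝ (Fin n)) := by
  intro x hx
  have h := tendsto_measure_of_ae_tendsto_indicator_of_isFiniteMeasure
    (𝓝[{z : Fin n → ℝ | 0 ≤ z}] x) (hP.measurableSet x k) (fun z => hP.measurableSet z k)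
    (hμ.ae_le (hP.ae_eventually x hx.1 (ne_zero_of_mem_stdSimplex hx) k))
  exact ((ENNReal.tendsto_toReal (measure_ne_top μ _)).comp h).mono_left
    (nhdsWithin_mono x fun z hz => hz.1)

/-- The pieces cover the space; overlaps on the cuts only help the inequality. -/
theorem IsOrthantParametrization.measureReal_univ_le_sum {d n : ℕ}
    {A : Set (Fin n → Set (EuclideanSpace ℝ (Fin d)))}
    {P : (Fin n → ℝ) → Fin n → Set (EuclideanSpace ℝ (Fin d))} (hP : IsOrthantParametrization A P)
    (μ : Measure (EuclideanSpace ℝ (Fin d))) [IsFiniteMeasure μ] {x : Fin n → ℝ}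
    (hx : x ∈ stdSimplex ℝ (Fin n)) : μ.real Set.univ ≤ ∑ k, μ.real (P x k) := by
  have : (Set.univ : Set (EuclideanSpace ℝ (Fin d))) = ⋃ k, P x k :=
    (Set.eq_univ_of_forall fun y =>
      Set.mem_iUnion.2 (hP.exists_mem x hx.1 (ne_zero_of_mem_stdSimplex hx) y)).symm
  rw [this]
  exact measureReal_iUnion_fintype_le _

/-- A nested hyperplane partition that is envy-free for all but one of the agents, whichever piece
the remaining agent takes. -/
theorem IsNestedHyperplaneSpace.exists_matching_avoiding {d n : ℕ}
    {A : Set (Fin n → Set (EuclideanSpace ℝ (Fin d)))} (hA : IsNestedHyperplaneSpace n A)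
    {ι : Type*} [Fintype ι] (hcard : Fintype.card ι + 1 = n)
    (μ : ι → Measure (EuclideanSpace ℝ (Fin d))) (hfin : ∀ i, IsFiniteMeasure (μ i))
    (hμ : ∀ i, μ i ≪ volume) :
    ∃ C ∈ A, ∀ k, ∃ π : ι → Fin n, Function.Injective π ∧
      ∀ i, π i ≠ k ∧ ∀ j, μ i (C j) ≤ μ i (C (π i)) := by
  classical
  obtain ⟨P, hP⟩ := hA.exists_isOrthantParametrization
  obtain ⟨x, hx, h⟩ := exists_envyFree (I := Fin n) (by simpa using hcard)
    -- A zero measure has no positive total, so it is replaced by the coordinates; it envies nobody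
    -- in any case.
    (fun i k x => if μ i = 0 then x k else (μ i).real (P x k))
    (fun i k => by
      by_cases h : μ i = 0
      · simp only [h, if_true]
        exact (continuous_apply k).continuousOn
      · simp only [h, if_false]
        exact hP.continuousOn_measureReal (μ i) (hμ i) k)
    (fun i => if μ i = 0 then 1 else (μ i).real Set.univ)
    (fun i => by
      by_cases h : μ i = 0
      · simp [h]
      · simp only [h, if_false]
        exact ENNReal.toReal_pos (by simpa using h) (measure_ne_top _ _))
    (fun i x hx => by
      by_cases h : μ i = 0
      · simp only [h, if_true]
        exact hx.2.ge
      · simp only [h, if_false]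
        exact hP.measureReal_univ_le_sum (μ i) hx)
    (fun i k x hx hk => by
      by_cases h : μ i = 0
      · simp [h, hk]
      · simp [h, hP.eq_empty x hx.1 (ne_zero_of_mem_stdSimplex hx) k hk])
  refine ⟨P x, hP.mem x, fun k => ?_⟩
  obtain ⟨π, hπ, h'⟩ := h k
  refine ⟨π, hπ, fun i => ⟨(h' i).1, fun j => ?_⟩⟩
  by_cases h0 : μ i = 0
  · simp [h0]
  · have := (h' i).2 j
    simp only [h0, if_false] at this
    exact (ENNReal.toReal_le_toReal (measure_ne_top _ _) (measure_ne_top _ _)).1 this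

/-- The partition is chosen before `ν` is known; a matching of the others that avoids `k` leaves
exactly `k` for `i₀`. -/
theorem IsNestedHyperplaneSpace.exists_secretive_envyFree {d n : ℕ}
    {A : Set (Fin n → Set (EuclideanSpace ℝ (Fin d)))} (hA : IsNestedHyperplaneSpace n A)
    (i₀ : Fin n) (μ : {i : Fin n // i ≠ i₀} → Measure (EuclideanSpace ℝ (Fin d)))
    (hfin : ∀ i, IsFiniteMeasure (μ i)) (hμ : ∀ i, μ i ≪ volume) :
    ∃ C ∈ A, ∀ ν : Measure (EuclideanSpace ℝ (Fin d)), ∀ k : Fin n, (∀ j, ν (C j) ≤ ν (C k)) →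
      ∃ π : Equiv.Perm (Fin n), π i₀ = k ∧
        IsEnvyFreeAssignment (fun i => if h : i = i₀ then ν else μ ⟨i, h⟩) C π := by
  obtain ⟨C, hC, h⟩ := hA.exists_matching_avoiding (ι := {i : Fin n // i ≠ i₀}) (by
    have := i₀.pos
    rw [Fintype.card_subtype_compl, Fintype.card_fin, Fintype.card_subtype_eq]
    omega) μ hfin hμ
  refine ⟨C, hC, fun ν k hk => ?_⟩
  obtain ⟨π, hπ, h'⟩ := h k
  let f : Fin n → Fin n := fun i => if h : i = i₀ then k else π ⟨i, h⟩
  have hf : Function.Injective f := by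
    intro i j hij
    by_cases hi : i = i₀ <;> by_cases hj : j = i₀
    · rw [hi, hj]
    · simp only [f, hi, hj, dif_pos, dif_neg, not_false_eq_true] at hij
      exact absurd hij.symm (h' _).1
    · simp only [f, hi, hj, dif_pos, dif_neg, not_false_eq_true] at hij
      exact absurd hij (h' _).1
    · simp only [f, hi, hj, dif_neg, not_false_eq_true] at hij
      exact congrArg Subtype.val (hπ hij)
  refine ⟨Equiv.ofBijective f (Finite.injective_iff_bijective.1 hf), by simp [f], fun i j => ?_⟩
  by_cases hi : i = i₀
  · simpa [f, hi] using hk j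
  · simpa [f, hi] using (h' ⟨i, hi⟩).2 j

theorem mainTheorem9 (d n : ℕ) (hd : 1 ≤ d) (hn : 1 ≤ n)
    (A : Set (Fin n → Set (EuclideanSpace ℝ (Fin d))))
    (hA : IsNestedHyperplaneSpace n A) :
    (∀ μ : Fin n → Measure (EuclideanSpace ℝ (Fin d)),
      (∀ i, IsFiniteMeasure (μ i)) → (∀ i, μ i ≪ volume) →
      ∃ C ∈ A, IsEnvyFreePartition μ C) ∧
    (∀ (i₀ : Fin n) (μ : {i : Fin n // i ≠ i₀} → Measure (EuclideanSpace ℝ (Fin d))),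
      (∀ i, IsFiniteMeasure (μ i)) → (∀ i, μ i ≪ volume) →
      ∃ C ∈ A, ∀ ν : Measure (EuclideanSpace ℝ (Fin d)), IsFiniteMeasure ν → ν ≪ volume →
        ∀ k : Fin n, (∀ j, ν (C j) ≤ ν (C k)) →
          ∃ π : Equiv.Perm (Fin n), π i₀ = k ∧
            IsEnvyFreeAssignment (fun i => if h : i = i₀ then ν else μ ⟨i, h⟩) C π) := by
  constructor
  · intro μ hfin hμ
    let i₀ : Fin n := ⟨0, hn⟩
    obtain ⟨C, hC, h⟩ := hA.exists_secretive_envyFree i₀ (fun i => μ i) (fun i => hfin i)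
      (fun i => hμ i)
    have : Nonempty (Fin n) := ⟨i₀⟩
    obtain ⟨k, hk⟩ := Finite.exists_max fun j => μ i₀ (C j)
    obtain ⟨π, -, hπ⟩ := h (μ i₀) k hk
    refine ⟨C, hC, π, fun i j => ?_⟩
    have := hπ i j
    by_cases hi : i = i₀
    · simpa [hi] using this
    · simpa [hi] using this
  · intro i₀ μ hfin hμ
    obtain ⟨C, hC, h⟩ := hA.exists_secretive_envyFree i₀ μ hfin hμ
    exact ⟨C, hC, fun ν _ _ => h ν⟩
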